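/- Let $G$ and $H$ be Polish groups, i.e. topological groups whose topology is separable and completely metrizable. Call a Polish group TSI if it admits a compatible metric $d$ (one inducing its topology) that is two-sided invariant, i.e. $d(gx,gy)=d(x,y)=d(xg,yg)$ for all $g,x,y$. For a Polish group $K$, let $E(K)$ be the equivalence relation on $K^\omega$ given by $$x\,E(K)\,y\iff \lim_{n} x(n)y(n)^{-1}\text{ converges in }K.$$ If $H$ is TSI but $G$ is not, then $E(G)$ is not Borel reducible to $E(H)$, i.e. there is no Borel map $\theta:G^\omega\to H^\omega$ such that, for all $x,y\in G^\omega$, $x\,E(G)\,y\iff\theta(x)\,E(H)\,\theta(y)$. Here $G^\omega$ and $H^\omega$ carry the product topologies. -/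

import Mathlib

open Filter Topology

/-- The equivalence relation `E(G)` on the space of sequences of a topological group `G`:
`x` and `y` are equivalent when `x(n) y(n)⁻¹` converges in `G`. -/
def inducedSetoid (G : Type*) [Group G] [TopologicalSpace G] [IsTopologicalGroup G] :
    Setoid (ℕ → G) where
  r x y := ∃ g : G, Tendsto (fun n => x n * (y n)⁻¹) atTop (𝓝 g)
  iseqv :=
    { refl := fun x => ⟨1, by simp [tendsto_const_nhds]⟩
      symm := by
        rintro x y ⟨g, hg⟩
        exact ⟨g⁻¹, by simpa using hg.inv⟩
      trans := by
        rintro x y z ⟨g, hg⟩ ⟨h, hh⟩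
        exact ⟨g * h, by simpa [mul_assoc] using hg.mul hh⟩ }

/-- `E` is Borel reducible to `F`: some Borel map `f : X → Y` satisfies
`x E y ↔ f x F f y` for all `x` and `y`. -/
def BorelReducible {X Y : Type*} [TopologicalSpace X] [TopologicalSpace Y]
    (E : Setoid X) (F : Setoid Y) : Prop :=
  ∃ f : X → Y, @Measurable X Y (borel X) (borel Y) f ∧ ∀ x y : X, E x y ↔ F (f x) (f y)

/-- The topological group `G` is TSI: it admits a compatible two-sided invariant metric. -/
def IsTSI (G : Type*) [Group G] [t : TopologicalSpace G] : Prop :=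
  ∃ m : MetricSpace G, m.toUniformSpace.toTopologicalSpace = t ∧
    (∀ g x y : G, m.dist (g * x) (g * y) = m.dist x y) ∧
    (∀ g x y : G, m.dist (x * g) (y * g) = m.dist x y)

/-! Suppose `θ` reduces E(G) to E(H). As G is not TSI, there are `g j`, accumulating at 1, with all
conjugates `w j = h j * g j * (h j)⁻¹` outside a fixed neighbourhood U. Multiplying one coordinate
by `w j` (a spike) is a large change in G, yet a generic point can be so changed, arbitrarily far
out, with θ moving little in all coordinates at once (`generic_exists_small_conjugate_move`). Baire
category gives this for small spikes `g j`, up to an initial segment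
(`exists_open_tailClose_mulSingle`); a spike `w j` is a spike `g j` conjugated by a sequence
eventually equal to `h j`, which preserves E(G)-classes, and in H the errors add by two-sided
invariance. Iterating sparsely with summable errors gives a limit y. The θ-values converge
uniformly, so θ(y) E(H) θ(x₀); but y x₀⁻¹ lies outside U infinitely often and equals 1 infinitely
often (`not_inducedSetoid_of_sparse_changes`). -/

/-- A first countable Hausdorff group with small invariant neighbourhoods is TSI. -/
theorem isTSI_of_small_invariant {G : Type*} [Group G] [TopologicalSpace G]
    [IsTopologicalGroup G] [FirstCountableTopology G] [T0Space G]
    (hG : ∀ U ∈ 𝓝 (1 : G), ∃ V ∈ 𝓝 (1 : G), ∀ g ∈ V, ∀ h : G, h * g * h⁻¹ ∈ U) : IsTSI G := by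
  let : UniformSpace G := IsTopologicalGroup.rightUniformSpace G
  have hU : uniformity G = comap (fun p : G × G => p.2 * p.1⁻¹) (𝓝 1) := by
    rfl
  have : (uniformity G).IsCountablyGenerated := by
    rw [hU]; infer_instance
  let : MetricSpace G := UniformSpace.metricSpace G
  -- Truncation at 1 keeps the supremum over all two-sided translates finite.
  let F : G → G → G × G → ℝ := fun x y p => min (dist (p.1 * x * p.2) (p.1 * y * p.2)) 1
  have hF0 : ∀ x y p, 0 ≤ F x y p := fun x y p => le_min dist_nonneg zero_le_one
  have hbdd : ∀ x y, BddAbove (Set.range (F x y)) := fun x y =>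
    ⟨1, by rintro _ ⟨p, rfl⟩; exact min_le_right _ _⟩
  let D : G → G → ℝ := fun x y => ⨆ p, F x y p
  have hFD : ∀ x y p, F x y p ≤ D x y := fun x y p => le_ciSup (hbdd x y) p
  have hsmall : ∀ x : G, ∀ ε > 0, ∀ᶠ y in 𝓝 x, D x y < ε := by
    intro x ε hε
    have h1 : {p : G × G | dist p.1 p.2 < ε / 2} ∈ uniformity G :=
      Metric.dist_mem_uniformity (half_pos hε)
    rw [hU] at h1
    obtain ⟨O, hO, hOs⟩ := h1
    obtain ⟨V, hV, hVO⟩ := hG O hO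
    have h2 : Tendsto (fun y => y * x⁻¹) (𝓝 x) (𝓝 1) := by
      have : Continuous fun y : G => y * x⁻¹ := by fun_prop
      simpa using this.tendsto x
    filter_upwards [h2 hV] with y hy
    refine lt_of_le_of_lt (ciSup_le fun p => ?_) (half_lt_self hε)
    refine (min_le_left _ _).trans (le_of_lt ?_)
    have h3 : (p.1 * x * p.2, p.1 * y * p.2) ∈ {p : G × G | dist p.1 p.2 < ε / 2} := by
      apply hOs
      have := hVO _ hy p.1
      simp only [Set.mem_preimage]
      convert this using 1
      group
    exact h3
  have hcomp : ∀ s : Set G, IsOpen s ↔ ∀ x ∈ s, ∃ ε > 0, ∀ y, D x y < ε → y ∈ s := by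
    intro s
    constructor
    · intro hs x hx
      obtain ⟨ε, hε, hb⟩ := Metric.isOpen_iff.1 hs x hx
      refine ⟨min ε 1, lt_min hε one_pos, fun y hy => hb ?_⟩
      have h1 := (hFD x y (1, 1)).trans_lt hy
      simp only [F, one_mul, mul_one] at h1
      rw [Metric.mem_ball, dist_comm]
      by_contra hcon
      exact absurd h1 (not_lt.2 (min_le_min_right _ (not_lt.1 hcon)))
    · intro h
      rw [isOpen_iff_mem_nhds]
      intro x hx
      obtain ⟨ε, hε, hb⟩ := h x hx
      filter_upwards [hsmall x ε hε] with y hy using hb y hy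
  let m : MetricSpace G := MetricSpace.ofDistTopology D
    (fun x => by simp [D, F])
    (fun x y => by simp [D, F, dist_comm])
    (fun x y z => by
      refine ciSup_le fun p => ?_
      refine le_trans ?_ (add_le_add (hFD x y p) (hFD y z p))
      have h1 := dist_triangle (p.1 * x * p.2) (p.1 * y * p.2) (p.1 * z * p.2)
      simp only [F]
      have h2 := @dist_nonneg _ _ (p.1 * x * p.2) (p.1 * y * p.2)
      have h3 := @dist_nonneg _ _ (p.1 * y * p.2) (p.1 * z * p.2)
      rcases min_cases (dist (p.1 * x * p.2) (p.1 * y * p.2)) 1 with h | h <;>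
      rcases min_cases (dist (p.1 * y * p.2) (p.1 * z * p.2)) 1 with h' | h' <;>
      rcases min_cases (dist (p.1 * x * p.2) (p.1 * z * p.2)) 1 with h'' | h'' <;> linarith)
    hcomp
    (fun x y h => by
      have h1 := hFD x y (1, 1)
      rw [h] at h1
      simp only [F, one_mul, mul_one] at h1
      by_contra hne
      have := lt_min (dist_pos.2 hne) one_pos
      linarith)
  refine ⟨m, rfl, ?_, ?_⟩
  · intro g x y
    change D (g * x) (g * y) = D x y
    refine Equiv.iSup_congr ((Equiv.mulRight g).prodCongr (Equiv.refl G)) ?_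
    intro p
    simp [F, mul_assoc]
  · intro g x y
    change D (x * g) (y * g) = D x y
    refine Equiv.iSup_congr ((Equiv.refl G).prodCongr (Equiv.mulLeft g)) ?_
    intro p
    simp [F, mul_assoc]

theorem exists_sequences_of_not_isTSI {G : Type*} [Group G] [TopologicalSpace G]
    [IsTopologicalGroup G] [FirstCountableTopology G] [T0Space G] (hG : ¬ IsTSI G) :
    ∃ U ∈ 𝓝 (1 : G), ∃ g h : ℕ → G, (∀ O ∈ 𝓝 (1 : G), ∃ j, g j ∈ O) ∧
      ∀ j, h j * g j * (h j)⁻¹ ∉ U := by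
  have h1 : ∃ U ∈ 𝓝 (1 : G), ∀ V ∈ 𝓝 (1 : G), ∃ g ∈ V, ∃ h : G, h * g * h⁻¹ ∉ U := by
    by_contra hcon
    push Not at hcon
    exact hG (isTSI_of_small_invariant hcon)
  obtain ⟨U, hU, hUV⟩ := h1
  obtain ⟨B, hB⟩ := (𝓝 (1 : G)).exists_antitone_basis
  choose g hg h hh using fun j => hUV (B j) (hB.1.mem_of_mem trivial)
  refine ⟨U, hU, g, h, fun O hO => ?_, hh⟩
  obtain ⟨j, -, hj⟩ := hB.1.mem_iff.1 hO
  exact ⟨j, hj (hg j)⟩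

/-! ### Baire category tools. -/

theorem exists_generic_mem {X : Type*} [TopologicalSpace X] [BaireSpace X] {p : X → Prop}
    (hp : ∀ᶠ x in residual X, p x) {V : Set X} (hV : IsOpen V) (hne : V.Nonempty) :
    ∃ x ∈ V, p x :=
  (dense_of_mem_residual hp).inter_open_nonempty V hV hne

/-- If countably many Borel sets cover an open set up to a meagre set, then one of them is
comeagre in a smaller open set. -/
theorem exists_open_generic_of_cover {X : Type*} [TopologicalSpace X] [BaireSpace X]
    [MeasurableSpace X] [BorelSpace X] {ι : Type*} [Countable ι] {A : ι → Set X}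
    (hA : ∀ i, MeasurableSet (A i)) {V : Set X} (hV : IsOpen V) (hne : V.Nonempty)
    (hcov : ∀ᶠ x in residual X, x ∈ V → ∃ i, x ∈ A i) :
    ∃ i, ∃ W ⊆ V, IsOpen W ∧ W.Nonempty ∧ ∀ᶠ x in residual X, x ∈ W → x ∈ A i := by
  choose U hUo hU using fun i => (hA i).residualEq_isOpen
  by_cases h : ∃ i, (V ∩ U i).Nonempty
  · obtain ⟨i, hi⟩ := h
    refine ⟨i, V ∩ U i, Set.inter_subset_left, hV.inter (hUo i), hi, ?_⟩
    filter_upwards [(hU i).mem_iff] with x hx hxV using hx.2 hxV.2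
  · exfalso
    push Not at h
    have hall : ∀ᶠ x in residual X, ∀ i, (x ∈ A i ↔ x ∈ U i) :=
      eventually_countable_forall.2 fun i => (hU i).mem_iff
    obtain ⟨x, hxV, hx1, hx2⟩ := exists_generic_mem (hall.and hcov) hV hne
    obtain ⟨i, hi⟩ := hx2 hxV
    have : x ∈ V ∩ U i := ⟨hxV, (hx1 i).1 hi⟩
    simp [h i] at this

/-- By the Baire property the exceptional set is open up to a meagre set; were that open set
nonempty, `p` would fail generically on it. -/
theorem generic_of_frequently {X : Type*} [TopologicalSpace X]
    [MeasurableSpace X] [BorelSpace X] {p : X → Prop} (hp : MeasurableSet {x | p x})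
    (h : ∀ V : Set X, IsOpen V → V.Nonempty → ¬ ∀ᶠ x in residual X, x ∈ V → ¬ p x) :
    ∀ᶠ x in residual X, p x := by
  obtain ⟨V, hVo, hV⟩ := hp.compl.residualEq_isOpen
  have hne : ¬ V.Nonempty := fun hne => h V hVo hne <| by
    filter_upwards [hV.mem_iff] with x hx hxV using hx.2 hxV
  rw [Set.not_nonempty_iff_eq_empty] at hne
  filter_upwards [hV.mem_iff] with x hx
  by_contra hxS
  have := hx.1 hxS
  simp [hne] at this

/-- A measurable map into a separable metric space generically oscillates little on some open
set. -/
theorem exists_open_generic_dist_le {X Y : Type*} [TopologicalSpace X] [BaireSpace X]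
    [MeasurableSpace X] [BorelSpace X] [MetricSpace Y] [SecondCountableTopology Y]
    [MeasurableSpace Y] [BorelSpace Y] {f : X → Y} (hf : Measurable f) {ε : ℝ} (hε : 0 < ε)
    {V : Set X} (hV : IsOpen V) (hne : V.Nonempty) :
    ∃ p : Y, ∃ W ⊆ V, IsOpen W ∧ W.Nonempty ∧ ∀ᶠ x in residual X, x ∈ W → dist (f x) p ≤ ε := by
  have ⟨x₀, _⟩ := hne
  have : Nonempty Y := ⟨f x₀⟩
  obtain ⟨i, W, h⟩ := exists_open_generic_of_cover (ι := ℕ)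
    (A := fun i => {x | dist (f x) (TopologicalSpace.denseSeq Y i) ≤ ε})
    (fun i => measurableSet_le (hf.dist measurable_const) measurable_const) hV hne
    (Eventually.of_forall fun x _ => by
      obtain ⟨i, hi⟩ := (TopologicalSpace.denseRange_denseSeq Y).exists_dist_lt (f x) hε
      exact ⟨i, hi.le⟩)
  exact ⟨_, W, h⟩

/-- Lets coordinates from `N` on be changed without leaving the open set. -/
theorem exists_cylinder_subset {G : Type*} [TopologicalSpace G] {V : Set (ℕ → G)}
    (hV : IsOpen V) (hne : V.Nonempty) :
    ∃ W ⊆ V, IsOpen W ∧ W.Nonempty ∧ ∃ N : ℕ, ∀ M ≥ N, ∀ x y : ℕ → G, (∀ n < M, x n = y n) →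
      x ∈ W → y ∈ W := by
  obtain ⟨x, hx⟩ := hne
  obtain ⟨I, u, hu, hsub⟩ := isOpen_pi_iff.1 hV x hx
  refine ⟨(I : Set ℕ).pi u, hsub, isOpen_set_pi I.finite_toSet fun i hi => (hu i hi).1,
    ⟨x, fun i hi => (hu i hi).2⟩, I.sup id + 1, fun M hM y z hyz hy i hi => ?_⟩
  rw [← hyz i]
  · exact hy i hi
  · have : i ≤ I.sup id := Finset.le_sup (f := id) hi
    omega

/-! ### Tail estimates under a two-sided invariant metric. -/

/-- The quotients `u v⁻¹` vary by at most `ε` from the index `K` on. -/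
def TailClose {H : Type*} [Group H] [Dist H] (K : ℕ) (ε : ℝ) (u v : ℕ → H) : Prop :=
  ∀ m ≥ K, ∀ k ≥ K, dist (u m * (v m)⁻¹) (u k * (v k)⁻¹) ≤ ε

section TwoSidedInvariant

variable {H : Type*} [Group H] [MetricSpace H]

theorem dist_mul_mul_le_add (hl : ∀ g x y : H, dist (g * x) (g * y) = dist x y)
    (hr : ∀ g x y : H, dist (x * g) (y * g) = dist x y) (a b c d : H) :
    dist (a * b) (c * d) ≤ dist a c + dist b d := by
  calc dist (a * b) (c * d) ≤ dist (a * b) (c * b) + dist (c * b) (c * d) := dist_triangle _ _ _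
    _ = _ := by rw [hl, hr]

theorem dist_inv_inv_of_invariant (hl : ∀ g x y : H, dist (g * x) (g * y) = dist x y)
    (hr : ∀ g x y : H, dist (x * g) (y * g) = dist x y) (a b : H) :
    dist a⁻¹ b⁻¹ = dist a b := by
  rw [← hl a, ← hr b]
  simp [dist_comm]

theorem dist_mul_inv_one (hr : ∀ g x y : H, dist (x * g) (y * g) = dist x y) (a b : H) :
    dist (a * b⁻¹) 1 = dist a b := by
  rw [← hr b]
  simp

theorem TailClose.mono {K L : ℕ} (hKL : K ≤ L) {ε δ : ℝ} (hεδ : ε ≤ δ) {u v : ℕ → H}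
    (h : TailClose K ε u v) : TailClose L δ u v :=
  fun m hm k hk => (h m (hKL.trans hm) k (hKL.trans hk)).trans hεδ

theorem TailClose.symm (hl : ∀ g x y : H, dist (g * x) (g * y) = dist x y)
    (hr : ∀ g x y : H, dist (x * g) (y * g) = dist x y) {K : ℕ} {ε : ℝ} {u v : ℕ → H}
    (h : TailClose K ε u v) : TailClose K ε v u := by
  intro m hm k hk
  have := h m hm k hk
  rw [← dist_inv_inv_of_invariant hl hr] at this
  simpa using this

theorem TailClose.trans (hl : ∀ g x y : H, dist (g * x) (g * y) = dist x y)
    (hr : ∀ g x y : H, dist (x * g) (y * g) = dist x y) {K : ℕ} {ε δ : ℝ} {u v w : ℕ → H}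
    (h : TailClose K ε u v) (h' : TailClose K δ v w) : TailClose K (ε + δ) u w := by
  intro m hm k hk
  have := dist_mul_mul_le_add hl hr (u m * (v m)⁻¹) (v m * (w m)⁻¹) (u k * (v k)⁻¹)
    (v k * (w k)⁻¹)
  simp only [mul_assoc, inv_mul_cancel_left] at this
  exact this.trans (add_le_add (by simpa using h m hm k hk) (by simpa using h' m hm k hk))

/-- Index `K` belongs to both ranges, so the initial bound there carries over to the tail. -/
theorem TailClose.dist_le (hr : ∀ g x y : H, dist (x * g) (y * g) = dist x y) {K : ℕ} {ε δ : ℝ}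
    {u v : ℕ → H} (h : TailClose K ε u v) (hinit : ∀ k ≤ K, dist (u k) (v k) ≤ δ)
    (hε : 0 ≤ ε) (k : ℕ) : dist (u k) (v k) ≤ ε + δ := by
  rcases le_total k K with hk | hk
  · linarith [hinit k hk]
  · have h1 := h k hk K le_rfl
    have h2 := hinit K le_rfl
    rw [← dist_mul_inv_one hr] at h2 ⊢
    exact (dist_triangle _ _ _).trans (add_le_add h1 h2)

theorem exists_tailClose_of_tendsto {u v : ℕ → H} {l : H}
    (h : Tendsto (fun n => u n * (v n)⁻¹) atTop (𝓝 l)) {ε : ℝ} (hε : 0 < ε) :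
    ∃ K, TailClose K ε u v := by
  obtain ⟨K, hK⟩ := Metric.cauchySeq_iff.1 h.cauchySeq ε hε
  exact ⟨K, fun m hm k hk => (hK m hm k hk).le⟩

theorem measurableSet_tailClose [IsTopologicalGroup H] [SecondCountableTopology H]
    [MeasurableSpace H] [BorelSpace H] {X : Type*} [MeasurableSpace X] {f g : X → ℕ → H}
    (hf : Measurable f) (hg : Measurable g) (K : ℕ) (ε : ℝ) :
    MeasurableSet {x | TailClose K ε (f x) (g x)} := by
  simp only [TailClose, Set.ofPred_forall]
  have hmeas : ∀ m, Measurable fun x => f x m * (g x m)⁻¹ := fun m =>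
    ((measurable_pi_apply m).comp hf).mul ((measurable_pi_apply m).comp hg).inv
  exact MeasurableSet.iInter fun m => MeasurableSet.iInter fun _ => MeasurableSet.iInter fun k =>
    MeasurableSet.iInter fun _ => measurableSet_le ((hmeas m).dist (hmeas k)) measurable_const

end TwoSidedInvariant

/-! ### Convergent sequences as a Polish group of continuous maps. -/

theorem eventually_residual_mul_left {X : Type*} [Group X] [TopologicalSpace X]
    [ContinuousMul X] {p : X → Prop} (hp : ∀ᶠ x in residual X, p x) (a : X) :
    ∀ᶠ x in residual X, p (a * x) :=
  tendsto_residual_of_isOpenMap (continuous_const_mul a) (isOpenMap_mul_left a) hp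

/-- The convergent sequence which is `g` at `n` and `1` elsewhere. -/
noncomputable def convergentSingle {G : Type*} [Group G] [TopologicalSpace G] (n : ℕ) (g : G) :
    C(OnePoint ℕ, G) :=
  OnePoint.continuousMapMkNat (Pi.mulSingle n g) 1 <| by
    refine tendsto_const_nhds.congr' ?_
    filter_upwards [eventually_gt_atTop n] with k hk
    simp [Pi.mulSingle_eq_of_ne hk.ne']

theorem convergentSingle_coe {G : Type*} [Group G] [TopologicalSpace G] (n : ℕ) (g : G) (k : ℕ) :
    convergentSingle n g (k : OnePoint ℕ) = (Pi.mulSingle n g : ℕ → G) k := rfl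

theorem convergentSingle_infty {G : Type*} [Group G] [TopologicalSpace G] (n : ℕ) (g : G) :
    convergentSingle n g OnePoint.infty = 1 := rfl

/-- `O` serves every `n`, since the uniform distance from a spike to 1 does not depend on its
position. -/
theorem exists_nhds_convergentSingle_mem {G : Type*} [Group G] [TopologicalSpace G]
    [IsTopologicalGroup G] [PolishSpace G] {R : Set C(OnePoint ℕ, G)} (hR : R ∈ 𝓝 1) :
    ∃ O ∈ 𝓝 (1 : G), ∀ n, ∀ g ∈ O, convergentSingle n g ∈ R := by
  let := TopologicalSpace.upgradeIsCompletelyMetrizable G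
  obtain ⟨ε, hε, hb⟩ := Metric.mem_nhds_iff.1 hR
  refine ⟨Metric.ball 1 ε, Metric.ball_mem_nhds _ hε, fun n g hg => hb ?_⟩
  rw [Metric.mem_ball, ContinuousMap.dist_lt_iff hε]
  intro x
  induction x using OnePoint.rec with
  | infty => simpa [convergentSingle_infty] using hε
  | coe k =>
    rw [convergentSingle_coe]
    rcases eq_or_ne k n with rfl | hk
    · simpa using hg
    · simpa [Pi.mulSingle_eq_of_ne hk] using hε

/-- The sequence of values at the finite points. -/
def ContinuousMap.toSeq {G : Type*} [TopologicalSpace G] (c : C(OnePoint ℕ, G)) : ℕ → G :=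
  fun n => c (n : OnePoint ℕ)

theorem continuous_toSeq {G : Type*} [TopologicalSpace G] :
    Continuous (ContinuousMap.toSeq : C(OnePoint ℕ, G) → ℕ → G) :=
  continuous_pi fun n => continuous_eval_const (n : OnePoint ℕ)

theorem tendsto_toSeq {G : Type*} [TopologicalSpace G] (c : C(OnePoint ℕ, G)) :
    Tendsto c.toSeq atTop (𝓝 (c OnePoint.infty)) := by
  have h1 : Tendsto ((↑) : ℕ → OnePoint ℕ) atTop (𝓝 OnePoint.infty) := by
    have := OnePoint.tendsto_coe_infty (X := ℕ)
    rwa [Filter.coclosedCompact_eq_cocompact, Filter.cocompact_eq_cofinite, Nat.cofinite_eq_atTop] at this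
  exact (c.continuous.tendsto _).comp h1

/-- The map is the homeomorphism (c, x) ↦ (c, cx) followed by a projection. Openness lets comeagre
sets be pulled back along it. -/
theorem isOpenMap_toSeq_mul {G : Type*} [Group G] [TopologicalSpace G] [IsTopologicalGroup G] :
    IsOpenMap fun p : C(OnePoint ℕ, G) × (ℕ → G) => p.1.toSeq * p.2 := by
  let e : C(OnePoint ℕ, G) × (ℕ → G) ≃ₜ C(OnePoint ℕ, G) × (ℕ → G) :=
    { toFun := fun p => (p.1, p.1.toSeq * p.2)
      invFun := fun p => (p.1, (p.1.toSeq)⁻¹ * p.2)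
      left_inv := fun p => by simp
      right_inv := fun p => by simp
      continuous_toFun := continuous_fst.prodMk
        ((continuous_toSeq.comp continuous_fst).mul continuous_snd)
      continuous_invFun := continuous_fst.prodMk
        ((continuous_toSeq.comp continuous_fst).inv.mul continuous_snd) }
  exact isOpenMap_snd.comp e.isOpenMap

theorem baireSpace_convergent_prod {G : Type*} [TopologicalSpace G] [PolishSpace G] :
    BaireSpace (C(OnePoint ℕ, G) × (ℕ → G)) := by
  let := TopologicalSpace.upgradeIsCompletelyMetrizable G
  infer_instance

/-! ### Generic behaviour of a Borel homomorphism. -/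

section Homomorphism

variable {G H : Type*} [Group G] [TopologicalSpace G] [IsTopologicalGroup G] [PolishSpace G]
  [MeasurableSpace G] [BorelSpace G] [Group H] [MetricSpace H] [IsTopologicalGroup H]
  [SecondCountableTopology H] [MeasurableSpace H] [BorelSpace H]

/-- On some open set, generic points are moved by a uniformly small amount when one coordinate is
multiplied by an element near `1`. -/
theorem exists_open_tailClose_mulSingle
    (hl : ∀ g x y : H, dist (g * x) (g * y) = dist x y)
    (hr : ∀ g x y : H, dist (x * g) (y * g) = dist x y)
    {θ : (ℕ → G) → ℕ → H} (hθ : Measurable θ)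
    (hom : ∀ x y, inducedSetoid G x y → inducedSetoid H (θ x) (θ y))
    {ε : ℝ} (hε : 0 < ε) {V : Set (ℕ → G)} (hV : IsOpen V) (hne : V.Nonempty) :
    ∃ K, ∃ W ⊆ V, IsOpen W ∧ W.Nonempty ∧ ∃ O ∈ 𝓝 (1 : G), ∀ n, ∀ g ∈ O,
      ∀ᶠ x in residual (ℕ → G), x ∈ W → TailClose K ε (θ x) (θ (Pi.mulSingle n g * x)) := by
  have : BaireSpace (C(OnePoint ℕ, G) × (ℕ → G)) := baireSpace_convergent_prod
  let : MeasurableSpace C(OnePoint ℕ, G) := borel _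
  have : BorelSpace C(OnePoint ℕ, G) := ⟨rfl⟩
  let μ : C(OnePoint ℕ, G) × (ℕ → G) → ℕ → G := fun p => p.1.toSeq * p.2
  have hμc : Continuous μ := (continuous_toSeq.comp continuous_fst).mul continuous_snd
  have hμo : IsOpenMap μ := isOpenMap_toSeq_mul
  obtain ⟨K, W₀, hW₀V, hW₀, ⟨⟨c₀, x₀⟩, hp₀⟩, hA⟩ := exists_open_generic_of_cover
    (A := fun K => {p : C(OnePoint ℕ, G) × (ℕ → G) | TailClose K (ε / 2) (θ p.2) (θ (μ p))})
    (fun K => measurableSet_tailClose (hθ.comp measurable_snd) (hθ.comp hμc.measurable) K _)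
    (hV.preimage hμc)
    (by
      obtain ⟨x, hx⟩ := hne
      refine ⟨(1, x), ?_⟩
      have : μ (1, x) = x := by ext n; simp [μ, ContinuousMap.toSeq]
      simpa [this] using hx)
    (Eventually.of_forall fun p _ => by
      obtain ⟨l, hl'⟩ := hom p.2 (μ p) ⟨(p.1 OnePoint.infty)⁻¹, by
        simpa [μ] using (tendsto_toSeq p.1).inv⟩
      exact exists_tailClose_of_tendsto hl' (half_pos hε))
  obtain ⟨Q, W', hQ, hW', hcQ, hxW', hbox⟩ := isOpen_prod_iff.1 hW₀ c₀ x₀ hp₀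
  have hmul : Tendsto (fun p : C(OnePoint ℕ, G) × C(OnePoint ℕ, G) => p.1 * p.2)
      (𝓝 1 ×ˢ 𝓝 c₀) (𝓝 c₀) := by
    rw [← nhds_prod_eq]
    simpa using (continuous_mul (M := C(OnePoint ℕ, G))).tendsto (1, c₀)
  obtain ⟨R, hR, Q₁, hQ₁, hRQ⟩ := mem_prod_iff.1 (hmul (hQ.mem_nhds hcQ))
  obtain ⟨O, hO, hOR⟩ := exists_nhds_convergentSingle_mem hR
  let Q₂ := interior Q₁ ∩ Q
  have hQ₂ : IsOpen Q₂ := isOpen_interior.inter hQ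
  have hQ₂W : IsOpen (Q₂ ×ˢ W') := hQ₂.prod hW'
  have hWo : IsOpen (μ '' (Q₂ ×ˢ W')) := hμo _ hQ₂W
  refine ⟨K, μ '' (Q₂ ×ˢ W'), ?_, hWo, ⟨_, (c₀, x₀), ⟨⟨mem_interior_iff_mem_nhds.2 hQ₁, hcQ⟩,
    hxW'⟩, rfl⟩, O, hO, fun n g hg => ?_⟩
  · rintro _ ⟨p, hp, rfl⟩
    exact hW₀V (hbox ⟨hp.1.2, hp.2⟩)
  have hmeas : MeasurableSet {x | x ∈ μ '' (Q₂ ×ˢ W') →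
      TailClose K ε (θ x) (θ (Pi.mulSingle n g * x))} := by
    have h1 := measurableSet_tailClose hθ
      (hθ.comp (continuous_const_mul (Pi.mulSingle n g : ℕ → G)).measurable) K ε
    have h2 := hWo.measurableSet.compl.union h1
    convert h2 using 1
    ext x
    simp only [Set.mem_ofPred_eq, Set.mem_union, Set.mem_compl_iff, Function.comp]
    tauto
  refine generic_of_frequently hmeas fun V₁ hV₁ hV₁ne hcon => ?_
  obtain ⟨z, hz, hz'⟩ := exists_generic_mem hcon hV₁ hV₁ne
  have hzW : z ∈ μ '' (Q₂ ×ˢ W') := by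
    have := hz' hz
    simp only [Classical.not_imp] at this
    exact this.1
  obtain ⟨p₁, hp₁, rfl⟩ := hzW
  have hpull : ∀ᶠ p in residual (C(OnePoint ℕ, G) × (ℕ → G)), μ p ∈ V₁ →
      ¬ (μ p ∈ μ '' (Q₂ ×ˢ W') → TailClose K ε (θ (μ p)) (θ (Pi.mulSingle n g * μ p))) :=
    tendsto_residual_of_isOpenMap hμc hμo hcon
  -- Translating by the spike changes c but not x, so θ(cx) and θ(spike · cx) are both compared with
  -- the same θ(x).
  have hA' := eventually_residual_mul_left hA (convergentSingle n g, 1)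
  obtain ⟨⟨c, x⟩, ⟨hp, hpV⟩, h1, h2, h3⟩ := exists_generic_mem (hpull.and (hA.and hA'))
    (hQ₂W.inter (hV₁.preimage hμc)) ⟨p₁, hp₁, hz⟩
  refine h1 hpV fun _ => ?_
  have h4 : TailClose K (ε / 2) _ _ := h2 (hbox ⟨hp.1.2, hp.2⟩)
  have h5 : TailClose K (ε / 2) _ _ := h3 (hbox ⟨hRQ (Set.mk_mem_prod (hOR n g hg) (interior_subset hp.1.1)), by
    simpa using hp.2⟩)
  have h6 := (h4.symm hl hr).trans (w := θ (μ ((convergentSingle n g, 1) * (c, x)))) hl hr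
    (by simpa using h5)
  rw [add_halves] at h6
  have h7 : μ ((convergentSingle n g, 1) * (c, x)) = Pi.mulSingle n g * μ (c, x) := by
    ext k
    simp [μ, ContinuousMap.toSeq, convergentSingle_coe, mul_assoc]
  rw [h7] at h6
  simpa using h6

/-- If `g` accumulates at `1`, then generic points are moved by a small amount when one
coordinate is multiplied by a suitable conjugate `h j * g j * (h j)⁻¹`. -/
theorem generic_exists_small_conjugate_move
    (hl : ∀ g x y : H, dist (g * x) (g * y) = dist x y)
    (hr : ∀ g x y : H, dist (x * g) (y * g) = dist x y)
    {θ : (ℕ → G) → ℕ → H} (hθ : Measurable θ)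
    (hom : ∀ x y, inducedSetoid G x y → inducedSetoid H (θ x) (θ y))
    {Y : Type*} [MetricSpace Y] [SecondCountableTopology Y] [MeasurableSpace Y] [BorelSpace Y]
    {f : (ℕ → G) → Y} (hf : Measurable f) {g h : ℕ → G}
    (hg : ∀ O ∈ 𝓝 (1 : G), ∃ j, g j ∈ O) {ε : ℝ} (hε : 0 < ε) (N : ℕ) :
    ∀ᶠ x in residual (ℕ → G), ∃ n ≥ N, ∃ j,
      (∀ k, dist (θ x k) (θ (Pi.mulSingle n (h j * g j * (h j)⁻¹) * x) k) ≤ ε) ∧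
      dist (f x) (f (Pi.mulSingle n (h j * g j * (h j)⁻¹) * x)) ≤ ε := by
  have hmeas : MeasurableSet {x | ∃ n ≥ N, ∃ j,
      (∀ k, dist (θ x k) (θ (Pi.mulSingle n (h j * g j * (h j)⁻¹) * x) k) ≤ ε) ∧
      dist (f x) (f (Pi.mulSingle n (h j * g j * (h j)⁻¹) * x)) ≤ ε} := by
    have hm : ∀ a : ℕ → G, Measurable fun x : ℕ → G => a * x := fun a =>
      (continuous_const_mul a).measurable
    simp only [Set.ofPred_exists, Set.ofPred_and, Set.ofPred_forall]
    refine MeasurableSet.iUnion fun n => (MeasurableSet.const _).inter <|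
      MeasurableSet.iUnion fun j => MeasurableSet.inter (MeasurableSet.iInter fun k => ?_) ?_
    · exact measurableSet_le (((measurable_pi_apply k).comp hθ).dist
        ((measurable_pi_apply k).comp (hθ.comp (hm _)))) measurable_const
    · exact measurableSet_le (hf.dist (hf.comp (hm _))) measurable_const
  refine generic_of_frequently hmeas fun V hV hVne hcon => ?_
  obtain ⟨V₁, hV₁V, hV₁, hV₁ne, N₁, hN₁⟩ := exists_cylinder_subset hV hVne
  -- Three tail comparisons and two oscillation bounds are added up, giving 5ε/9.
  have hε' : 0 < ε / 9 := by positivity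
  obtain ⟨K₀, W, hWV, hW, hWne, O, hO, hK₀⟩ :=
    exists_open_tailClose_mulSingle hl hr hθ hom hε' hV₁ hV₁ne
  obtain ⟨j, hj⟩ := hg O hO
  let M := max N N₁
  -- Since `M ≥ N₁`, multiplying by `τ` keeps points of `V₁` in `V₁`; at positions beyond `M` it
  -- conjugates a spike `g j` into the required one.
  let τ : ℕ → G := fun n => if M ≤ n then h j else 1
  have hτm : Measurable fun x : ℕ → G => τ * x := (continuous_const_mul τ).measurable
  obtain ⟨K₁, W₁, hW₁W, hW₁, hW₁ne, hK₁⟩ := exists_open_generic_of_cover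
    (A := fun K => {x : ℕ → G | TailClose K (ε / 9) (θ x) (θ (τ * x))})
    (fun K => measurableSet_tailClose hθ (hθ.comp hτm) K _) hW hWne
    (Eventually.of_forall fun x _ => by
      obtain ⟨l, hl'⟩ := hom x (τ * x) ⟨(h j)⁻¹, by
        refine tendsto_const_nhds.congr' ?_
        filter_upwards [eventually_ge_atTop M] with n hn
        simp [τ, hn]⟩
      exact exists_tailClose_of_tendsto hl' hε')
  let K := max K₀ K₁
  -- Tail closeness says nothing before `K`; small oscillation controls these finitely many
  -- coordinates, and `f` along with them.
  obtain ⟨p, W₂, hW₂W, hW₂, hW₂ne, hosc⟩ := exists_open_generic_dist_le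
    (f := fun x => ((fun k : Fin (K + 1) => θ (τ * x) k, f (τ * x)) : (Fin (K + 1) → H) × Y))
    ((measurable_pi_lambda (fun x (k : Fin (K + 1)) => θ (τ * x) k) fun k =>
      (measurable_pi_apply (k : ℕ)).comp (hθ.comp hτm)).prodMk (hf.comp hτm))
    hε' hW₁ hW₁ne
  obtain ⟨W₃, hW₃W, hW₃, hW₃ne, N₃, hN₃⟩ := exists_cylinder_subset hW₂ hW₂ne
  let n := max M N₃
  let s : ℕ → G := Pi.mulSingle n (g j)
  obtain ⟨x, hx, ha, hb, hb', hc, hc', hd⟩ := exists_generic_mem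
    ((hK₀ n (g j) hj).and <| hK₁.and <| (eventually_residual_mul_left hK₁ s).and <|
      hosc.and <| (eventually_residual_mul_left hosc s).and <|
      eventually_residual_mul_left hcon τ) hW₃ hW₃ne
  have hsx : s * x ∈ W₃ := by
    refine hN₃ n (le_max_right _ _) x _ (fun k hk => ?_) hx
    simp [s, Pi.mulSingle_eq_of_ne hk.ne]
  have hτV : τ * x ∈ V₁ := by
    refine hN₁ M (le_max_right _ _) x _ (fun k hk => ?_) (hWV (hW₁W (hW₂W (hW₃W hx))))
    simp [τ, not_le.2 hk]
  have hcomm : Pi.mulSingle n (h j * g j * (h j)⁻¹) * (τ * x) = τ * (s * x) := by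
    ext k
    rcases eq_or_ne k n with rfl | hk
    · simp [τ, s, n, mul_assoc]
    · simp [s, Pi.mulSingle_eq_of_ne hk]
  have hclose : TailClose K (ε / 9 + ε / 9 + ε / 9) (θ (τ * x)) (θ (τ * (s * x))) :=
    ((((hb (hW₂W (hW₃W hx))).mono (le_max_right K₀ K₁) le_rfl).symm hl hr).trans hl hr
      ((ha (hW₁W (hW₂W (hW₃W hx)))).mono (le_max_left K₀ K₁) le_rfl)).trans hl hr
      ((hb' (hW₂W (hW₃W hsx))).mono (le_max_right K₀ K₁) le_rfl)
  have hpair := (dist_triangle_right _ _ p).trans (add_le_add (hc (hW₃W hx)) (hc' (hW₃W hsx)))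
  rw [Prod.dist_eq, max_le_iff] at hpair
  refine hd (hV₁V hτV) ⟨n, (le_max_left _ _).trans (le_max_left _ _), j, fun k => ?_, ?_⟩
  · rw [hcomm]
    refine (hclose.dist_le hr (δ := ε / 9 + ε / 9) (fun i hi => ?_) (by positivity) k).trans ?_
    · exact (dist_pi_le_iff (by positivity)).1 hpair.1 ⟨i, Nat.lt_succ_of_le hi⟩
    · linarith
  · rw [hcomm]
    refine hpair.2.trans ?_
    linarith

end Homomorphism

/-! ### Iteration and passage to the limit. -/

/-- A Borel map on a Polish space becomes continuous after a Polish refinement of the topology. -/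
theorem exists_complete_refinement.{u, v} {X : Type u} {Z : Type v} [t : TopologicalSpace X] [PolishSpace X]
    [mX : MeasurableSpace X] [hX : BorelSpace X] [TopologicalSpace Z] [SecondCountableTopology Z]
    [MeasurableSpace Z] [BorelSpace Z] {θ : X → Z} (hθ : Measurable θ) :
    ∃ (Y : Type u) (_ : MetricSpace Y) (_ : CompleteSpace Y) (_ : SecondCountableTopology Y)
      (f : X → Y) (g : Y → X), @Measurable X Y _ (borel Y) f ∧ Continuous g ∧
      Continuous (θ ∘ g) ∧ ∀ x, g (f x) = x := by
  obtain ⟨t', hle, hc, hpol⟩ := hθ.exists_continuous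
  let u := @TopologicalSpace.upgradeIsCompletelyMetrizable X t'
    (@PolishSpace.toIsCompletelyMetrizableSpace X t' hpol)
  refine ⟨X, u.toMetricSpace, u.toCompleteSpace, hpol.toSecondCountableTopology, id, id, ?_,
    continuous_id_iff_le.2 hle, hc, fun _ => rfl⟩
  have hb : @borel X t' = @borel X t :=
    MeasureTheory.borel_eq_borel_of_le hpol ‹@PolishSpace X t› hle
  intro s hs
  have hs' : @MeasurableSet X (@borel X t') s := hs
  rw [hb, ← @BorelSpace.measurable_eq X t mX hX] at hs'
  exact hs'

/-- A separate type carries the complete metric, so that it does not clash with the invariant metric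
on H. -/
theorem exists_homeomorph_complete.{u} (H : Type u) [TopologicalSpace H] [PolishSpace H] :
    ∃ (Z : Type u) (_ : MetricSpace Z) (_ : CompleteSpace Z), Nonempty (H ≃ₜ Z) := by
  let u := TopologicalSpace.upgradeIsCompletelyMetrizable H
  exact ⟨H, u.toMetricSpace, u.toCompleteSpace, ⟨Homeomorph.refl H⟩⟩

/-- If every step changes one coordinate beyond a moving threshold, and the changes stay away from
`1`, then the limit is not equivalent to the initial sequence. -/
theorem not_inducedSetoid_of_sparse_changes {G : Type*} [Group G] [TopologicalSpace G]
    [IsTopologicalGroup G] [T2Space G] {U : Set G} (hU : U ∈ 𝓝 (1 : G)) {x : ℕ → ℕ → G}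
    {n N : ℕ → ℕ} {v : ℕ → G} (hn : ∀ i, N i ≤ n i) (hN : ∀ i, N (i + 1) = n i + 2)
    (hv : ∀ i, v i ∉ U) (hx : ∀ i, x (i + 1) = Pi.mulSingle (n i) (v i) * x i)
    {y : ℕ → G} (hy : Tendsto x atTop (𝓝 y)) : ¬ inducedSetoid G y (x 0) := by
  rintro ⟨c, hc⟩
  have hNmono : ∀ i, N i < N (i + 1) := fun i => by have := hn i; have := hN i; omega
  have hNsm : StrictMono N := strictMono_nat_of_lt_succ hNmono
  have hout : ∀ i k, k ≠ n i → x (i + 1) k = x i k := fun i k hk => by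
    simp [hx i, Pi.mulSingle_eq_of_ne hk]
  have hearly : ∀ i k, N i ≤ k → x i k = x 0 k := by
    intro i
    induction i with
    | zero => simp
    | succ i ih =>
      intro k hk
      have := hN i
      have := hn i
      rw [hout i k (by omega), ih k (by omega)]
  have hlate : ∀ i k, k < N i → y k = x i k := by
    intro i k hk
    have hconst : ∀ m, x (i + m) k = x i k := by
      intro m
      induction m with
      | zero => rfl
      | succ m ih =>
        have := hNsm.monotone (Nat.le_add_right i m)
        have := hn (i + m)
        rw [← add_assoc, hout _ _ (by omega), ih]
    refine tendsto_nhds_unique (tendsto_pi_nhds.1 hy k) ?_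
    refine tendsto_const_nhds.congr' ?_
    filter_upwards [eventually_ge_atTop i] with m hm
    obtain ⟨d, rfl⟩ := Nat.exists_eq_add_of_le hm
    exact (hconst d).symm
  have hnt : Tendsto n atTop atTop :=
    tendsto_atTop_mono (fun i => (hNsm.id_le i).trans (hn i)) tendsto_id
  have h1 : ∀ i, y (n i) * (x 0 (n i))⁻¹ = v i := fun i => by
    rw [hlate (i + 1) (n i) (by rw [hN]; omega), hx i, ← hearly i (n i) (hn i)]
    simp
  -- The `+ 2` in `hN` leaves coordinate `n i + 1` untouched forever, which forces the limit `c` to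
  -- be 1.
  have h2 : ∀ i, y (n i + 1) * (x 0 (n i + 1))⁻¹ = 1 := fun i => by
    rw [hlate (i + 1) (n i + 1) (by rw [hN]; omega), hout i _ (by omega),
      hearly i _ (by have := hn i; omega)]
    simp
  have h3 := hc.comp ((tendsto_add_atTop_nat 1).comp hnt)
  have hc1 : c = 1 := by
    refine tendsto_nhds_unique h3 (tendsto_const_nhds.congr fun i => ?_)
    simp [h2]
  have h4 := hc.comp hnt
  rw [hc1] at h4
  obtain ⟨i, hi⟩ := (h4.eventually_mem hU).exists
  exact hv i (by simpa [h1] using hi)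

theorem theorem3 {G : Type*} {H : Type*}
    [Group G] [TopologicalSpace G] [IsTopologicalGroup G] [PolishSpace G]
    [Group H] [TopologicalSpace H] [IsTopologicalGroup H] [PolishSpace H]
    (hH : IsTSI H) (hG : ¬ IsTSI G) :
    ¬ BorelReducible (inducedSetoid G) (inducedSetoid H) := by
  rintro ⟨θ, hθ, hred⟩
  obtain ⟨U, hU, g, h, hg, hgU⟩ := exists_sequences_of_not_isTSI hG
  obtain ⟨m, rfl, hl, hr⟩ := hH
  let : MeasurableSpace G := borel G
  have : BorelSpace G := ⟨rfl⟩
  let : MeasurableSpace H := borel H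
  have : BorelSpace H := ⟨rfl⟩
  have hθm : Measurable θ := by
    have h1 : (MeasurableSpace.pi : MeasurableSpace (ℕ → G)) = borel _ := BorelSpace.measurable_eq
    have h2 : (MeasurableSpace.pi : MeasurableSpace (ℕ → H)) = borel _ := BorelSpace.measurable_eq
    rwa [h1, h2]
  obtain ⟨Y, _, _, _, f, p, hf, hp, hθp, hpf⟩ := exists_complete_refinement hθm
  obtain ⟨Z, _, _, ⟨e⟩⟩ := exists_homeomorph_complete H
  let : MeasurableSpace Y := borel Y
  have : BorelSpace Y := ⟨rfl⟩
  let w : ℕ → G := fun j => h j * g j * (h j)⁻¹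
  let s : ℕ × ℕ → ℕ → G := fun q => Pi.mulSingle q.1 (w q.2)
  have hhalf : ∀ i : ℕ, (0 : ℝ) < (1 / 2) ^ i := fun i => by positivity
  -- Quantifying over all finite products of spikes makes the property survive each step; it stays
  -- comeagre because these products are countably many.
  let Good : (ℕ → G) → Prop := fun x => ∀ l : List (ℕ × ℕ), ∀ i N : ℕ, ∃ n ≥ N, ∃ j,
    (∀ k, dist (θ ((l.map s).prod * x) k)
      (θ (Pi.mulSingle n (w j) * ((l.map s).prod * x)) k) ≤ (1 / 2) ^ i) ∧
    dist (f ((l.map s).prod * x)) (f (Pi.mulSingle n (w j) * ((l.map s).prod * x))) ≤ (1 / 2) ^ i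
  have hGood : ∀ᶠ x in residual (ℕ → G), Good x := by
    refine eventually_countable_forall.2 fun l => eventually_countable_forall.2 fun i =>
      eventually_countable_forall.2 fun N => ?_
    exact eventually_residual_mul_left (generic_exists_small_conjugate_move hl hr hθm
      (fun x y => (hred x y).1) hf hg (hhalf i) N) _
  have hGood_mul : ∀ x, Good x → ∀ n j, Good (Pi.mulSingle n (w j) * x) := by
    intro x hx n j l
    have := hx (l ++ [(n, j)])
    simpa [s, mul_assoc] using this
  obtain ⟨x₀, -, hx₀⟩ := exists_generic_mem hGood isOpen_univ ⟨1, trivial⟩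
  have hlim : ∀ x, ∃ l, inducedSetoid G x x₀ →
      Tendsto (fun n => θ x n * (θ x₀ n)⁻¹) atTop (𝓝 l) := by
    intro x
    by_cases hx : inducedSetoid G x x₀
    · obtain ⟨l, hl'⟩ := (hred x x₀).1 hx
      exact ⟨l, fun _ => hl'⟩
    · exact ⟨1, fun h => absurd h hx⟩
  choose lim hlim using hlim
  have hstep : ∀ (i : ℕ) (a : {x // Good x ∧ inducedSetoid G x x₀} × ℕ),
      ∃ (b : {x // Good x ∧ inducedSetoid G x x₀} × ℕ) (n j : ℕ), a.2 ≤ n ∧ b.2 = n + 2 ∧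
        b.1.1 = Pi.mulSingle n (w j) * a.1.1 ∧
        (∀ k, dist (θ a.1.1 k) (θ b.1.1 k) ≤ 1 * (1 / 2) ^ i) ∧
        dist (f a.1.1) (f b.1.1) ≤ 1 * (1 / 2) ^ i ∧
        dist (e (lim a.1.1)) (e (lim b.1.1)) ≤ 1 * (1 / 2) ^ i := by
    rintro i ⟨⟨x, hx, hxE⟩, N⟩
    -- The limits in H must also converge. They are made Cauchy in the complete metric of `Z`, by
    -- moving them less than a δ given by continuity of `e`.
    obtain ⟨δ, hδ, hδe⟩ := Metric.continuous_iff.1 e.continuous (lim x) _ (hhalf i)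
    obtain ⟨q, hq⟩ := exists_pow_lt_of_lt_one hδ (by norm_num : (1 / 2 : ℝ) < 1)
    obtain ⟨n, hn, j, hj1, hj2⟩ := hx [] (max i q) N
    simp only [List.map_nil, List.prod_nil, one_mul] at hj1 hj2
    have hi : (1 / 2 : ℝ) ^ max i q ≤ (1 / 2) ^ i :=
      pow_le_pow_of_le_one (by norm_num) (by norm_num) (le_max_left _ _)
    have hq' : (1 / 2 : ℝ) ^ max i q ≤ (1 / 2) ^ q :=
      pow_le_pow_of_le_one (by norm_num) (by norm_num) (le_max_right _ _)
    have hE : inducedSetoid G (Pi.mulSingle n (w j) * x) x₀ := by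
      refine (inducedSetoid G).trans ⟨1, tendsto_const_nhds.congr' ?_⟩ hxE
      filter_upwards [eventually_gt_atTop n] with k hk
      simp [Pi.mulSingle_eq_of_ne hk.ne']
    refine ⟨(⟨_, hGood_mul x hx n j, hE⟩, n + 2), n, j, hn, rfl, rfl, fun k => ?_, ?_, ?_⟩
    · rw [one_mul]; exact (hj1 k).trans hi
    · rw [one_mul]; exact hj2.trans hi
    · have h1 : dist (lim x) (lim (Pi.mulSingle n (w j) * x)) ≤ (1 / 2) ^ max i q :=
        le_of_tendsto ((hlim x hxE).dist (hlim _ hE)) <| Eventually.of_forall fun k => by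
          rw [hr]; exact hj1 k
      rw [one_mul, dist_comm]
      refine (hδe _ ?_).le
      rw [dist_comm]
      linarith
  choose next pos idx hpos hnext hval hθd hfd hed using hstep
  let z : ℕ → {x // Good x ∧ inducedSetoid G x x₀} × ℕ := fun i =>
    Nat.rec (⟨x₀, hx₀, (inducedSetoid G).refl x₀⟩, 0) (fun i a => next i a) i
  let x : ℕ → ℕ → G := fun i => (z i).1.1
  obtain ⟨y', hy'⟩ := cauchySeq_tendsto_of_complete
    (cauchySeq_of_le_geometric (1 / 2) 1 (by norm_num) fun i => hfd i (z i))
  obtain ⟨l', hl'⟩ := cauchySeq_tendsto_of_complete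
    (cauchySeq_of_le_geometric (1 / 2) 1 (by norm_num) fun i => hed i (z i))
  have hxy : Tendsto x atTop (𝓝 (p y')) := by
    refine ((hp.tendsto y').comp hy').congr fun i => ?_
    simp [hpf, x]
  have hθy : Tendsto (fun i => θ (x i)) atTop (𝓝 (θ (p y'))) := by
    refine ((hθp.tendsto y').comp hy').congr fun i => ?_
    simp [hpf, x]
  have hlimy : Tendsto (fun i => lim (x i)) atTop (𝓝 (e.symm l')) := by
    refine ((e.symm.continuous.tendsto l').comp hl').congr fun i => ?_
    simp [x]
  have hunif : ∀ i k, dist (θ (x i) k) (θ (p y') k) ≤ 1 * (1 / 2) ^ i / (1 - 1 / 2) := fun i k =>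
    dist_le_of_le_geometric_of_tendsto (1 / 2) 1 (by norm_num) (fun i => hθd i (z i) k)
      (tendsto_pi_nhds.1 hθy k) i
  -- Interchange of limits: convergence in i is uniform in k.
  have hE : inducedSetoid H (θ (p y')) (θ x₀) := by
    refine ⟨e.symm l', Metric.tendsto_atTop.2 fun ε hε => ?_⟩
    have hgeom : Tendsto (fun i : ℕ => (1 : ℝ) * (1 / 2) ^ i / (1 - 1 / 2)) atTop (𝓝 0) := by
      have := (tendsto_pow_atTop_nhds_zero_of_lt_one (by norm_num : (0 : ℝ) ≤ 1 / 2)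
        (by norm_num)).const_mul 1 |>.div_const (1 - 1 / 2 : ℝ)
      simpa using this
    obtain ⟨i, hi1, hi2⟩ := ((hgeom.eventually_lt_const (by positivity : 0 < ε / 3)).and
      (Metric.tendsto_nhds.1 hlimy (ε / 3) (by positivity))).exists
    obtain ⟨K, hK⟩ := Metric.tendsto_atTop.1 (hlim (x i) (z i).1.2.2) (ε / 3) (by positivity)
    refine ⟨K, fun k hk => ?_⟩
    have h1 := hunif i k
    have h2 := hK k hk
    rw [← hr (θ x₀ k)⁻¹, dist_comm] at h1
    have h3 := dist_triangle4 (θ (p y') k * (θ x₀ k)⁻¹) (θ (x i) k * (θ x₀ k)⁻¹) (lim (x i))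
      (e.symm l')
    linarith
  exact not_inducedSetoid_of_sparse_changes hU (x := x) (n := fun i => pos i (z i))
    (N := fun i => (z i).2) (v := fun i => w (idx i (z i))) (fun i => hpos i (z i))
    (fun i => hnext i (z i)) (fun i => hgU _) (fun i => hval i (z i)) hxy ((hred _ _).2 hE)
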